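/- Let $n\ge 2$. Let $K_n=\{0,\dots,n-1\}^{\mathbb N}$ be the Cantor set of ends of the infinite rooted $n$-ary tree $\mathcal T_n$ (with the product topology); for a vertex $a$ of $\mathcal T_n$, i.e. a finite word in $\{0,\dots,n-1\}$, let $K_a\subset K_n$ be the set of infinite words with prefix $a$. Thompson's group $V_n\subset \mathrm{Homeo}(K_n)$ is the group of homeomorphisms $g$ described by a tree pair diagram $(A,B,\sigma)$: $A$ and $B$ are finite rooted subtrees of $\mathcal T_n$ containing its root, in which every vertex has either $0$ or $n$ children, $\sigma$ is a bijection from the endpoints (leaves) of $A$ to the endpoints of $B$, and $g(ax)=\sigma(a)x$ for every endpoint $a$ of $A$ and every $x\in K_n$ (so $g$ maps $K_a$ onto $K_{\sigma(a)}$ by changing the prefix). **Theorem.** For any finitely generated subgroup $\Gamma\subset V_n$, either the action of $\Gamma$ on $K_n$ has a finite orbit, i.e. there is $p\in K_n$ such that $\Gamma(p)=\{g(p) : g\in\Gamma\}$ is finite, or $\Gamma$ contains a free subgroup on two generators. (The two alternatives need not exclude each other.) -/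

import Mathlib

/-- The Cantor set `K_n`: the space of ends of the infinite rooted `n`-ary tree, whose vertices are
the finite words in `Fin n`. An end is an infinite word; the topology is the product topology. -/
abbrev CantorK (n : ℕ) : Type := ℕ → Fin n

/-- The end `w x` obtained by writing the finite word `w` in front of the infinite word `x`. The
elementary interval below the vertex `w` is the range of `prepend w`. -/
def prepend {n : ℕ} : List (Fin n) → CantorK n → CantorK n
  | [], x => x
  | i :: w, x => fun k => Nat.casesOn k i (fun m => prepend w x m)

/-- Finite `n`-ary rooted trees: every vertex has either no child or exactly `n` children, indexed
by `Fin n`. They are the finite full subtrees, containing the root, of the infinite `n`-ary tree. -/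
inductive NaryTree (n : ℕ) : Type
  | leaf : NaryTree n
  | node (child : Fin n → NaryTree n) : NaryTree n

/-- The endpoints (leaves) of a finite `n`-ary rooted tree, as vertices of the infinite tree. -/
def NaryTree.endpoints {n : ℕ} : NaryTree n → Set (List (Fin n))
  | .leaf => {[]}
  | .node child => {w | ∃ i, ∃ v ∈ (child i).endpoints, w = i :: v}

/-- The homeomorphism `g` of `K_n` is described by the tree pair diagram `(A, B, σ)`: for every
endpoint `a` of `A`, it maps the interval below `a` onto the interval below `σ a` by replacing the
prefix `a` with `σ a`. -/
def DescribedBy {n : ℕ} (g : CantorK n ≃ₜ CantorK n) (A B : NaryTree n)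
    (σ : A.endpoints ≃ B.endpoints) : Prop :=
  ∀ (a : A.endpoints) (x : CantorK n), g (prepend a.1 x) = prepend (σ a).1 x

theorem prepend_append {n : ℕ} (v w : List (Fin n)) (x : CantorK n) :
    prepend (v ++ w) x = prepend v (prepend w x) := by
  induction v with
  | nil => rfl
  | cons i v ih => funext k; cases k with
    | zero => rfl
    | succ k => exact congrFun ih k

theorem prepend_cons_inj {n : ℕ} {i j : Fin n} {v w : List (Fin n)} {x y : CantorK n} :
    prepend (i :: v) x = prepend (j :: w) y ↔ i = j ∧ prepend v x = prepend w y := by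
  constructor
  · intro h
    exact ⟨congrFun h 0, funext fun k => congrFun h (k + 1)⟩
  · rintro ⟨rfl, h⟩
    funext k
    cases k with
    | zero => rfl
    | succ k => exact congrFun h k

theorem exists_eq_prepend_singleton {n : ℕ} (x : CantorK n) :
    x = prepend [x 0] (fun k => x (k + 1)) := by
  funext k
  cases k <;> rfl

/-- The intervals below the endpoints of a tree partition `K_n`. -/
theorem NaryTree.existsUnique_endpoint {n : ℕ} (A : NaryTree n) (x : CantorK n) :
    ∃! a, a ∈ A.endpoints ∧ ∃ y, x = prepend a y := by
  induction A generalizing x with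
  | leaf => exact ⟨[], ⟨rfl, x, rfl⟩, fun a h => h.1⟩
  | node child ih =>
    obtain ⟨a, ⟨ha, y, hy⟩, hu⟩ := ih (x 0) (fun k => x (k + 1))
    refine ⟨x 0 :: a, ⟨⟨x 0, a, ha, rfl⟩, y, ?_⟩, ?_⟩
    · rw [exists_eq_prepend_singleton x, hy]
      exact (prepend_append [x 0] a y).symm
    · rintro b ⟨⟨i, v, hv, rfl⟩, z, hz⟩
      have h0 : x 0 = i := congrFun hz 0
      subst h0
      rw [hu v ⟨hv, z, funext fun k => congrFun hz (k + 1)⟩]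

theorem NaryTree.endpoints_finite {n : ℕ} (A : NaryTree n) : A.endpoints.Finite := by
  induction A with
  | leaf => exact Set.finite_singleton _
  | node child ih =>
    refine (Set.finite_iUnion fun i => (ih i).image (List.cons i)).subset ?_
    rintro w ⟨i, v, hv, rfl⟩
    exact Set.mem_iUnion.2 ⟨i, v, hv, rfl⟩

/-- Every finite partition of `K_n` into elementary intervals comes from a tree. -/
theorem NaryTree.exists_of_partition {n : ℕ} (hn : 0 < n) (L : ℕ) (S : Set (List (Fin n)))
    (hL : ∀ w ∈ S, w.length ≤ L) (hS : ∀ x : CantorK n, ∃! a, a ∈ S ∧ ∃ y, x = prepend a y) :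
    ∃ T : NaryTree n, T.endpoints = S := by
  induction L generalizing S with
  | zero =>
    have h0 : ∀ w ∈ S, w = [] := fun w hw => List.length_eq_zero_iff.1 (Nat.le_zero.1 (hL w hw))
    obtain ⟨a, ⟨ha, -⟩, -⟩ := hS (fun _ => ⟨0, hn⟩)
    refine ⟨.leaf, Set.ext fun w => ⟨?_, fun hw => h0 w hw⟩⟩
    rintro (rfl : w = [])
    rwa [← h0 a ha]
  | succ L ih =>
    by_cases hnil : [] ∈ S
    · refine ⟨.leaf, Set.ext fun w => ⟨?_, fun hw => ?_⟩⟩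
      · rintro (rfl : w = [])
        exact hnil
      · exact (hS (prepend w fun _ => ⟨0, hn⟩)).unique ⟨hw, _, rfl⟩ ⟨hnil, _, rfl⟩
    · have key : ∀ i : Fin n, ∃ T : NaryTree n, T.endpoints = {w | i :: w ∈ S} := by
        intro i
        refine ih _ (fun w hw => by simpa using hL _ hw) fun x => ?_
        obtain ⟨a, ⟨ha, y, hy⟩, hu⟩ := hS (prepend [i] x)
        cases a with
        | nil => exact absurd ha hnil
        | cons j a =>
          obtain ⟨rfl, hxy⟩ := prepend_cons_inj.1 hy
          refine ⟨a, ⟨ha, y, hxy⟩, ?_⟩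
          rintro b ⟨hb, z, hz⟩
          have := hu (i :: b) ⟨hb, z, prepend_cons_inj.2 ⟨rfl, hz⟩⟩
          exact (List.cons.inj this).2
      choose T hT using key
      refine ⟨.node T, Set.ext fun w => ⟨?_, fun hw => ?_⟩⟩
      · rintro ⟨i, v, hv, rfl⟩
        rw [hT i] at hv
        exact hv
      · cases w with
        | nil => exact absurd hw hnil
        | cons i w => exact ⟨i, w, by rw [hT i]; exact hw, rfl⟩

theorem describedBy_one {n : ℕ} :
    DescribedBy (1 : CantorK n ≃ₜ CantorK n) .leaf .leaf (Equiv.refl _) :=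
  fun _ _ => rfl

theorem DescribedBy.inv {n : ℕ} {g : CantorK n ≃ₜ CantorK n} {A B : NaryTree n}
    {σ : A.endpoints ≃ B.endpoints} (h : DescribedBy g A B σ) :
    DescribedBy g⁻¹ B A σ.symm := by
  intro b x
  have := h (σ.symm b) x
  rw [Equiv.apply_symm_apply] at this
  rw [← this]
  exact g.symm_apply_apply _

/-- A homeomorphism that replaces prefixes along the endpoints of a tree is given by a tree pair. -/
theorem exists_describedBy {n : ℕ} (hn : 0 < n) (g : CantorK n ≃ₜ CantorK n) (A : NaryTree n)
    (h : ∀ a ∈ A.endpoints, ∃ b, ∀ x, g (prepend a x) = prepend b x) :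
    ∃ (B : NaryTree n) (σ : A.endpoints ≃ B.endpoints), DescribedBy g A B σ := by
  choose! f hf using h
  have hfin : (f '' A.endpoints).Finite := A.endpoints_finite.image f
  have hinj : Set.InjOn f A.endpoints := by
    intro a ha b hb hab
    have e : prepend a (fun _ => ⟨0, hn⟩) = prepend b (fun _ => ⟨0, hn⟩) :=
      g.injective (by rw [hf a ha, hf b hb, hab])
    exact (A.existsUnique_endpoint _).unique ⟨ha, _, rfl⟩ ⟨hb, _, e⟩
  obtain ⟨L, hL⟩ := (hfin.image List.length).bddAbove
  obtain ⟨B, hB⟩ := NaryTree.exists_of_partition hn L (f '' A.endpoints)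
    (fun w hw => hL ⟨w, hw, rfl⟩) (by
      intro x
      obtain ⟨a, ⟨ha, y, hy⟩, hu⟩ := A.existsUnique_endpoint (g.symm x)
      refine ⟨f a, ⟨⟨a, ha, rfl⟩, y, ?_⟩, ?_⟩
      · rw [← hf a ha, ← hy, g.apply_symm_apply]
      · rintro b ⟨⟨c, hc, rfl⟩, z, hz⟩
        rw [hu c ⟨hc, z, by rw [hz, ← hf c hc, g.symm_apply_apply]⟩])
  refine ⟨B, (hinj.bijOn_image.equiv f).trans (Equiv.setCongr hB.symm), ?_⟩
  intro a x
  exact hf a.1 a.2 x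

/-- Every long enough word starts with an endpoint of a given tree. -/
theorem NaryTree.exists_prefix {n : ℕ} (A : NaryTree n) :
    ∃ L : ℕ, ∀ w : List (Fin n), L ≤ w.length → ∃ a ∈ A.endpoints, ∃ u, w = a ++ u := by
  induction A with
  | leaf => exact ⟨0, fun w _ => ⟨[], rfl, w, rfl⟩⟩
  | node child ih =>
    choose L hL using ih
    refine ⟨(∑ i, L i) + 1, fun w hw => ?_⟩
    cases w with
    | nil => simp at hw
    | cons i w =>
      have h1 : L i ≤ ∑ i, L i := Finset.single_le_sum (fun _ _ => Nat.zero_le _) (Finset.mem_univ i)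
      have h2 : (∑ i, L i) ≤ w.length := by simpa using hw
      obtain ⟨a, ha, u, rfl⟩ := hL i w (h1.trans h2)
      exact ⟨i :: a, ⟨i, a, ha, rfl⟩, u, rfl⟩

theorem NaryTree.exists_length_eq {n : ℕ} (N : ℕ) :
    ∃ T : NaryTree n, ∀ w ∈ T.endpoints, w.length = N := by
  induction N with
  | zero => exact ⟨.leaf, fun w hw => by rw [show w = [] from hw]; rfl⟩
  | succ N ih =>
    obtain ⟨T, hT⟩ := ih
    refine ⟨.node fun _ => T, ?_⟩
    rintro w ⟨i, v, hv, rfl⟩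
    simp [hT v hv]

theorem DescribedBy.mul {n : ℕ} (hn : 0 < n) {g h : CantorK n ≃ₜ CantorK n}
    {A B C D : NaryTree n} {σ : A.endpoints ≃ B.endpoints} {τ : C.endpoints ≃ D.endpoints}
    (hg : DescribedBy g A B σ) (hh : DescribedBy h C D τ) :
    ∃ (E F : NaryTree n) (ρ : E.endpoints ≃ F.endpoints), DescribedBy (g * h) E F ρ := by
  obtain ⟨L, hL⟩ := A.exists_prefix
  obtain ⟨M, hM⟩ := C.exists_prefix
  obtain ⟨K, hK⟩ := (C.endpoints_finite.image List.length).bddAbove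
  obtain ⟨T, hT⟩ := NaryTree.exists_length_eq (n := n) (M + (K + L))
  refine ⟨T, exists_describedBy hn _ T fun w hw => ?_⟩
  have hw' := hT w hw
  obtain ⟨c, hc, u, rfl⟩ := hM w (by omega)
  have hcK : c.length ≤ K := hK ⟨c, hc, rfl⟩
  rw [List.length_append] at hw'
  obtain ⟨a, ha, v, hv⟩ := hL ((τ ⟨c, hc⟩).1 ++ u) (by rw [List.length_append]; omega)
  refine ⟨(σ ⟨a, ha⟩).1 ++ v, fun x => ?_⟩
  have e : h (prepend (c ++ u) x) = prepend a (prepend v x) := by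
    rw [prepend_append, hh ⟨c, hc⟩, ← prepend_append, hv, prepend_append]
  rw [Homeomorph.mul_apply, e, hg ⟨a, ha⟩, prepend_append]

/-- Thompson's group `V_n`: the homeomorphisms of `K_n` that have a tree pair diagram. -/
def ThompsonV (n : ℕ) : Subgroup (CantorK n ≃ₜ CantorK n) where
  carrier := {g | ∃ (A B : NaryTree n) (σ : A.endpoints ≃ B.endpoints), DescribedBy g A B σ}
  one_mem' := ⟨_, _, _, describedBy_one⟩
  inv_mem' := by
    rintro g ⟨A, B, σ, h⟩
    exact ⟨B, A, σ.symm, h.inv⟩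
  mul_mem' := by
    rintro g h ⟨A, B, σ, hg⟩ ⟨C, D, τ, hh⟩
    rcases Nat.eq_zero_or_pos n with rfl | hn
    · exact ⟨.leaf, .leaf, Equiv.refl _, fun _ x => (x 0).elim0⟩
    · exact hg.mul hn hh

/-!
Suppose first that `Γ` has an invariant finitely additive probability measure on the Cantor set. An
end whose neighbourhoods all have mass at least `δ > 0` then has a finite orbit. Such an end exists
if some elementary interval of positive mass has infinitely many elementary intervals as images,
which accumulate at an end, or if the vertices on the way to some end have images of bounded depth
and positive mass.

Without an invariant mean, the averaging operator of a symmetric generating set on `ℓ²` has norm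
less than one, and the probability that a random word replaces one given prefix by another decays
exponentially in the length of the word. Hence a deep elementary interval stays deep with high
probability, and long random words map most elementary intervals into boundedly many very small
ones. By the union bound, finitely many random words do this to each other's target intervals, and
quotients of two such words play ping-pong.
-/

open Filter Topology
open scoped BigOperators

/-- A mean on `X`: a finitely additive probability defined on all subsets of `X`. -/
structure Mean (X : Type*) where
  mass : Set X → ℝ
  mass_nonneg : ∀ A, 0 ≤ mass A
  mass_univ : mass Set.univ = 1
  mass_union : ∀ A B, Disjoint A B → mass (A ∪ B) = mass A + mass B

namespace Mean

variable {G X Y : Type*} [Group G] [MulAction G X] [MulAction G Y]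

theorem mass_empty (m : Mean X) : m.mass ∅ = 0 := by
  have h := m.mass_union ∅ ∅ disjoint_bot_left
  rw [Set.union_empty] at h
  linarith

theorem mass_mono (m : Mean X) {A B : Set X} (h : A ⊆ B) : m.mass A ≤ m.mass B := by
  have hB := m.mass_union A (B \ A) Set.disjoint_sdiff_right
  rw [Set.union_sdiff_cancel h] at hB
  linarith [m.mass_nonneg (B \ A)]

theorem mass_le_one (m : Mean X) (A : Set X) : m.mass A ≤ 1 :=
  m.mass_univ ▸ m.mass_mono (Set.subset_univ A)

theorem mass_biUnion (m : Mean X) {ι : Type*} (s : Finset ι) (A : ι → Set X)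
    (h : (s : Set ι).PairwiseDisjoint A) : m.mass (⋃ i ∈ s, A i) = ∑ i ∈ s, m.mass (A i) := by
  classical
  induction s using Finset.induction_on with
  | empty => simp [mass_empty]
  | insert a s ha ih =>
    have hdisj : Disjoint (A a) (⋃ i ∈ s, A i) := by
      rw [Set.disjoint_iUnion₂_right]
      exact fun i hi => h (by simp) (by simp [hi]) (ne_of_mem_of_not_mem hi ha).symm
    rw [Finset.set_biUnion_insert, Finset.sum_insert ha, m.mass_union _ _ hdisj,
      ih (h.subset (by simp))]

/-- The push-forward of a mean. -/
def map (m : Mean X) (π : X → Y) : Mean Y where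
  mass A := m.mass (π ⁻¹' A)
  mass_nonneg _ := m.mass_nonneg _
  mass_univ := m.mass_univ
  mass_union _ _ h := m.mass_union _ _ (h.preimage π)

variable (G) in
/-- Invariance of a mean under a group action. -/
def IsInvariant (m : Mean X) : Prop :=
  ∀ (g : G) (A : Set X), m.mass ((g • ·) ⁻¹' A) = m.mass A

theorem IsInvariant.map {m : Mean X} (hm : m.IsInvariant G) {π : X → Y}
    (hπ : ∀ (g : G) x, π (g • x) = g • π x) : (m.map π).IsInvariant G := by
  intro g A
  have h : π ⁻¹' ((g • ·) ⁻¹' A) = (g • ·) ⁻¹' (π ⁻¹' A) := by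
    ext x
    simp [hπ]
  simp only [Mean.map, h, hm g]

theorem IsInvariant.mass_image {m : Mean X} (hm : m.IsInvariant G) (g : G) (A : Set X) :
    m.mass ((g • ·) '' A) = m.mass A := by
  rw [← hm g, Set.preimage_image_eq _ (MulAction.injective g)]

theorem isInvariant_of_closure_eq_top {m : Mean X} {S : Set G} (hS : Subgroup.closure S = ⊤)
    (h : ∀ g ∈ S, ∀ A, m.mass ((g • ·) ⁻¹' A) = m.mass A) : m.IsInvariant G := by
  intro g
  have hg : g ∈ Subgroup.closure S := hS ▸ Subgroup.mem_top g
  induction hg using Subgroup.closure_induction with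
  | mem g hg => exact h g hg
  | one => simp
  | mul g k _ _ hg hk =>
    intro A
    rw [← hg A, ← hk ((g • ·) ⁻¹' A)]
    simp only [Set.preimage_preimage, mul_smul]
  | inv g _ hg =>
    intro A
    rw [← hg]
    simp [Set.preimage_preimage]

theorem exists_tendsto_ultrafilter {ι : Type*} (U : Ultrafilter ι) (m : ι → Mean X) :
    ∃ μ : Mean X, ∀ A, Tendsto (fun j => (m j).mass A) U (𝓝 (μ.mass A)) := by
  have hlim (A : Set X) : ∃ a, Tendsto (fun j => (m j).mass A) U (𝓝 a) := by
    obtain ⟨a, -, ha⟩ := (isCompact_Icc (a := (0 : ℝ)) (b := 1)).ultrafilter_le_nhds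
      (U.map fun j => (m j).mass A) (le_principal_iff.2 (mem_map.2 (univ_mem' fun j =>
        ⟨(m j).mass_nonneg A, (m j).mass_le_one A⟩)))
    exact ⟨a, ha⟩
  choose μ hμ using hlim
  refine ⟨⟨μ, fun A => ge_of_tendsto' (hμ A) fun j => (m j).mass_nonneg A, ?_, ?_⟩, hμ⟩
  · exact tendsto_nhds_unique (hμ Set.univ) (by simp [mass_univ])
  · intro A B hAB
    refine tendsto_nhds_unique (hμ (A ∪ B)) ?_
    simpa only [mass_union _ A B hAB] using (hμ A).add (hμ B)

end Mean

/-- Square-summable real functions on a set. -/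
abbrev EllTwo (Ω : Type*) : Type _ := lp (fun _ : Ω => ℝ) 2

namespace EllTwo

variable {Ω : Type*}

theorem memℓp_two_iff {f : Ω → ℝ} : Memℓp f 2 ↔ Summable fun ω => f ω ^ 2 := by
  rw [memℓp_gen_iff (by norm_num)]
  simp

theorem summable_sq (f : EllTwo Ω) : Summable fun ω => f ω ^ 2 :=
  memℓp_two_iff.1 (lp.memℓp f)

theorem norm_sq (f : EllTwo Ω) : ‖f‖ ^ 2 = ∑' ω, f ω ^ 2 := by
  simpa using lp.norm_rpow_eq_tsum (p := 2) (by norm_num) f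

theorem indicator_sq (A : Set Ω) (f : Ω → ℝ) (ω : Ω) :
    A.indicator f ω ^ 2 = A.indicator (fun ω => f ω ^ 2) ω := by
  by_cases h : ω ∈ A <;> simp [h]

/-- Multiplication by the indicator function of a set. -/
noncomputable def restrict (A : Set Ω) : EllTwo Ω →ₗ[ℝ] EllTwo Ω where
  toFun f := ⟨A.indicator f, memℓp_two_iff.2 <| by
    simpa only [indicator_sq] using (summable_sq f).indicator A⟩
  map_add' f g := Subtype.ext (Set.indicator_add A f g)
  map_smul' c f := Subtype.ext (Set.indicator_const_smul A c f)

theorem restrict_apply (A : Set Ω) (f : EllTwo Ω) (ω : Ω) :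
    restrict A f ω = A.indicator f ω := rfl

theorem restrict_univ (f : EllTwo Ω) : restrict Set.univ f = f := by
  ext ω
  simp [restrict_apply]

theorem norm_restrict_union_sq {A B : Set Ω} (h : Disjoint A B) (f : EllTwo Ω) :
    ‖restrict (A ∪ B) f‖ ^ 2 = ‖restrict A f‖ ^ 2 + ‖restrict B f‖ ^ 2 := by
  rw [norm_sq, norm_sq, norm_sq, ← (summable_sq _).tsum_add (summable_sq _)]
  refine tsum_congr fun ω => ?_
  simp only [restrict_apply, indicator_sq, Set.indicator_union_of_disjoint h (fun ω => f ω ^ 2)]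

/-- The mean with density `f ^ 2`, for a unit vector `f`. -/
noncomputable def mean (f : EllTwo Ω) (hf : ‖f‖ = 1) : Mean Ω where
  mass A := ‖restrict A f‖ ^ 2
  mass_nonneg _ := sq_nonneg _
  mass_univ := by rw [restrict_univ, hf, one_pow]
  mass_union _ _ h := norm_restrict_union_sq h f

theorem norm_restrict_le (A : Set Ω) (f : EllTwo Ω) : ‖restrict A f‖ ≤ ‖f‖ := by
  refine le_of_sq_le_sq ?_ (norm_nonneg _)
  have h := norm_restrict_union_sq (disjoint_compl_right (a := A)) f
  rw [Set.union_compl_self, restrict_univ] at h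
  linarith [sq_nonneg ‖restrict Aᶜ f‖]

theorem abs_mass_mean_sub_le {f g : EllTwo Ω} (hf : ‖f‖ = 1) (hg : ‖g‖ = 1) (A : Set Ω) :
    |(mean f hf).mass A - (mean g hg).mass A| ≤ 2 * ‖f - g‖ := by
  have hdiff : |‖restrict A f‖ - ‖restrict A g‖| ≤ ‖f - g‖ :=
    (abs_norm_sub_norm_le _ _).trans (map_sub (restrict A) f g ▸ norm_restrict_le A _)
  have hsum : |‖restrict A f‖ + ‖restrict A g‖| ≤ 2 := by
    rw [abs_of_nonneg (by positivity)]
    linarith [norm_restrict_le A f, norm_restrict_le A g]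
  simp only [mean, sq_sub_sq, abs_mul]
  exact mul_le_mul hsum hdiff (abs_nonneg _) zero_le_two

variable {G : Type*} [Group G] [MulAction G Ω]

/-- The permutation representation on square-summable functions. -/
noncomputable def translate (g : G) : EllTwo Ω →ₗᵢ[ℝ] EllTwo Ω where
  toFun f := ⟨fun ω => f (g⁻¹ • ω), memℓp_two_iff.2 <|
    (summable_sq f).comp_injective (MulAction.injective g⁻¹)⟩
  map_add' _ _ := rfl
  map_smul' _ _ := rfl
  norm_map' f := by
    refine (sq_eq_sq₀ (norm_nonneg _) (norm_nonneg _)).1 ?_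
    rw [norm_sq, norm_sq]
    exact (MulAction.toPerm g⁻¹).tsum_eq fun ω => f ω ^ 2

theorem translate_apply (g : G) (f : EllTwo Ω) (ω : Ω) : translate g f ω = f (g⁻¹ • ω) := rfl

theorem translate_one (f : EllTwo Ω) : translate (1 : G) f = f := by
  ext ω
  simp [translate_apply]

theorem restrict_translate (g : G) (A : Set Ω) (f : EllTwo Ω) :
    restrict A (translate g f) = translate g (restrict ((g • ·) ⁻¹' A) f) := by
  ext ω
  by_cases h : ω ∈ A <;> simp [restrict_apply, translate_apply, Set.indicator, h]

theorem mass_mean_preimage (g : G) {f : EllTwo Ω} (hf : ‖f‖ = 1) (A : Set Ω) :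
    (mean f hf).mass ((g • ·) ⁻¹' A) =
      (mean (translate g f) ((translate g).norm_map f ▸ hf)).mass A := by
  simp only [mean, restrict_translate, LinearIsometry.norm_map]

theorem exists_invariant_mean_of_almost_invariant {S : Set G} (hS : Subgroup.closure S = ⊤)
    {ι : Type*} {l : Filter ι} [NeBot l] {f : ι → EllTwo Ω} (hf : ∀ j, ‖f j‖ = 1)
    (h : ∀ g ∈ S, Tendsto (fun j => ‖translate g (f j) - f j‖) l (𝓝 0)) :
    ∃ m : Mean Ω, m.IsInvariant G := by
  obtain ⟨m, hm⟩ := Mean.exists_tendsto_ultrafilter (Ultrafilter.of l) fun j => mean (f j) (hf j)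
  refine ⟨m, Mean.isInvariant_of_closure_eq_top hS fun g hg A => ?_⟩
  have hle (j : ι) : ‖(mean (f j) (hf j)).mass ((g • ·) ⁻¹' A) - (mean (f j) (hf j)).mass A‖ ≤
      2 * ‖translate g (f j) - f j‖ := by
    rw [mass_mean_preimage]
    exact abs_mass_mean_sub_le _ _ A
  have hzero := squeeze_zero_norm hle <| by
    simpa only [mul_zero] using ((h g hg).mono_left (Ultrafilter.of_le l)).const_mul 2
  linarith [tendsto_nhds_unique ((hm ((g • ·) ⁻¹' A)).sub (hm A)) hzero]

variable {ι : Type*} [Fintype ι]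

/-- The averaging operator of a finite family of group elements. -/
noncomputable def average (S : ι → G) : EllTwo Ω →L[ℝ] EllTwo Ω :=
  (Fintype.card ι : ℝ)⁻¹ • ∑ i, (translate (S i)).toContinuousLinearMap

theorem average_apply (S : ι → G) (f : EllTwo Ω) :
    average S f = (Fintype.card ι : ℝ)⁻¹ • ∑ i, translate (S i) f := by
  simp [average]

theorem norm_average_le (S : ι → G) : ‖(average S : EllTwo Ω →L[ℝ] EllTwo Ω)‖ ≤ 1 := by
  refine ContinuousLinearMap.opNorm_le_bound _ zero_le_one fun f => ?_
  have hsum : ‖∑ i, translate (S i) f‖ ≤ Fintype.card ι * ‖f‖ := by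
    simpa using norm_sum_le Finset.univ fun i => translate (S i) f
  rw [average_apply, norm_smul, norm_inv, RCLike.norm_natCast, one_mul]
  exact inv_mul_le_of_le_mul₀ (Nat.cast_nonneg _) (norm_nonneg _) hsum

end EllTwo

theorem norm_sub_sq_le_of_norm_eq_one {E ι : Type*} [NormedAddCommGroup E]
    [InnerProductSpace ℝ E] [Fintype ι] {v : ι → E} (hv : ∀ i, ‖v i‖ = 1) (i j : ι) :
    ‖v i - v j‖ ^ 2 ≤ 2 * ((Fintype.card ι : ℝ) ^ 2 - ‖∑ i, v i‖ ^ 2) := by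
  have hsum : ∑ k, ∑ l, ‖v k - v l‖ ^ 2 = 2 * ((Fintype.card ι : ℝ) ^ 2 - ‖∑ i, v i‖ ^ 2) := by
    simp only [norm_sub_sq_real, hv, Finset.sum_add_distrib, Finset.sum_sub_distrib,
      ← Finset.mul_sum, ← sum_inner, ← inner_sum, real_inner_self_eq_norm_sq]
    simp only [one_pow, Finset.sum_const, Finset.card_univ, nsmul_eq_mul, mul_one]
    ring
  rw [← hsum]
  exact (Finset.single_le_sum (f := fun l => ‖v i - v l‖ ^ 2) (fun _ _ => sq_nonneg _)
    (Finset.mem_univ j)).trans (Finset.single_le_sum (f := fun k => ∑ l, ‖v k - v l‖ ^ 2)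
      (fun _ _ => Finset.sum_nonneg fun _ _ => sq_nonneg _) (Finset.mem_univ i))

theorem exists_seq_norm_eq_one_tendsto_norm {E F : Type*} [NormedAddCommGroup E] [NormedSpace ℝ E]
    [Nontrivial E] [NormedAddCommGroup F] [NormedSpace ℝ F] (T : E →L[ℝ] F) :
    ∃ f : ℕ → E, (∀ j, ‖f j‖ = 1) ∧ Tendsto (fun j => ‖T (f j)‖) atTop (𝓝 ‖T‖) := by
  have hbdd : BddAbove ((fun x => ‖T x‖) '' Metric.sphere 0 1) := by
    refine ⟨‖T‖, ?_⟩
    rintro _ ⟨x, hx, rfl⟩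
    exact T.unit_le_opNorm x (mem_sphere_zero_iff_norm.1 hx).le
  obtain ⟨u, -, hu, hmem⟩ := exists_seq_tendsto_sSup
    ((NormedSpace.sphere_nonempty.2 zero_le_one).image _) hbdd
  choose f hf hfu using hmem
  refine ⟨f, fun j => mem_sphere_zero_iff_norm.1 (hf j), ?_⟩
  rw [← T.sSup_sphere_eq_norm]
  exact hu.congr fun j => (hfu j).symm

namespace EllTwo

variable {G Ω ι : Type*} [Group G] [MulAction G Ω] [Fintype ι]

theorem norm_average_lt_one {S : ι → G} (hS : Subgroup.closure (Set.range S) = ⊤)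
    (h1 : 1 ∈ Set.range S) (h : ¬ ∃ m : Mean Ω, m.IsInvariant G) :
    ‖(average S : EllTwo Ω →L[ℝ] EllTwo Ω)‖ < 1 := by
  obtain ⟨i₀, h1⟩ := h1
  refine (norm_average_le S).lt_of_ne fun heq => h ?_
  have : Nontrivial (EllTwo Ω) := by
    refine not_subsingleton_iff_nontrivial.1 fun _ => one_ne_zero (heq.symm.trans ?_)
    rw [Subsingleton.elim (average S) 0, norm_zero]
  obtain ⟨f, hf, hlim⟩ :=
    exists_seq_norm_eq_one_tendsto_norm (average S : EllTwo Ω →L[ℝ] EllTwo Ω)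
  refine exists_invariant_mean_of_almost_invariant hS (l := atTop) hf ?_
  rintro _ ⟨i, rfl⟩
  have hle (j : ℕ) : ‖translate (S i) (f j) - f j‖ ^ 2 ≤
      2 * ((Fintype.card ι : ℝ) ^ 2 - (Fintype.card ι * ‖average S (f j)‖) ^ 2) := by
    have hcard : (Fintype.card ι : ℝ) ≠ 0 := Nat.cast_ne_zero.2 (Fintype.card_pos_iff.2 ⟨i⟩).ne'
    have hv := norm_sub_sq_le_of_norm_eq_one (v := fun i => translate (S i) (f j))
      (fun i => by rw [LinearIsometry.norm_map, hf]) i i₀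
    rwa [h1, translate_one, ← smul_inv_smul₀ hcard (∑ i, translate (S i) (f j)), ← average_apply,
      norm_smul, RCLike.norm_natCast] at hv
  have hsq : Tendsto (fun j => ‖translate (S i) (f j) - f j‖ ^ 2) atTop (𝓝 0) := by
    refine squeeze_zero (fun _ => sq_nonneg _) hle ?_
    rw [heq] at hlim
    convert (((hlim.const_mul (Fintype.card ι : ℝ)).pow 2).const_sub
      ((Fintype.card ι : ℝ) ^ 2)).const_mul 2 using 2
    ring
  simpa [Real.sqrt_sq (norm_nonneg _)] using hsq.sqrt

end EllTwo

/-- The vertex at depth `N` on the way to an end. -/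
def initialWord {n : ℕ} (y : CantorK n) (N : ℕ) : List (Fin n) :=
  (List.range N).map y

/-- The elementary interval below a vertex. -/
def cylinder {n : ℕ} (b : List (Fin n)) : Set (CantorK n) :=
  Set.range (prepend b)

section Words

variable {n : ℕ}

@[simp]
theorem length_initialWord (y : CantorK n) (N : ℕ) : (initialWord y N).length = N := by
  simp [initialWord]

theorem initialWord_succ (y : CantorK n) (N : ℕ) :
    initialWord y (N + 1) = initialWord y N ++ [y N] := by
  simp [initialWord, List.range_succ]

theorem initialWord_prefix_initialWord (y : CantorK n) {M N : ℕ} (h : M ≤ N) :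
    initialWord y M <+: initialWord y N := by
  induction N, h using Nat.le_induction with
  | base => exact List.prefix_rfl
  | succ N _ ih => exact ih.trans ⟨[y N], (initialWord_succ y N).symm⟩

theorem prepend_initialWord (y : CantorK n) (N : ℕ) :
    prepend (initialWord y N) (fun k => y (N + k)) = y := by
  induction N with
  | zero => simp [initialWord, prepend]
  | succ N ih =>
    conv_rhs => rw [← ih, exists_eq_prepend_singleton fun k => y (N + k)]
    rw [initialWord_succ, prepend_append]
    simp only [add_zero, add_comm 1, add_assoc]

theorem initialWord_prepend (b : List (Fin n)) (x : CantorK n) :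
    initialWord (prepend b x) b.length = b := by
  induction b with
  | nil => rfl
  | cons i b ih =>
    rw [initialWord, List.length_cons, List.range_succ_eq_map, List.map_cons, List.map_map]
    exact congrArg (List.cons i) ih

theorem mem_cylinder_iff {b : List (Fin n)} {y : CantorK n} :
    y ∈ cylinder b ↔ initialWord y b.length = b := by
  constructor
  · rintro ⟨x, rfl⟩
    exact initialWord_prepend b x
  · intro h
    exact ⟨_, h ▸ prepend_initialWord y b.length⟩

theorem mem_cylinder_initialWord (y : CantorK n) (N : ℕ) : y ∈ cylinder (initialWord y N) :=
  ⟨_, prepend_initialWord y N⟩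

theorem initialWord_prefix_of_mem_cylinder {b : List (Fin n)} {y : CantorK n}
    (hy : y ∈ cylinder b) {N : ℕ} (hN : N ≤ b.length) : initialWord y N <+: b :=
  mem_cylinder_iff.1 hy ▸ initialWord_prefix_initialWord y hN

theorem cylinder_subset_of_prefix {b c : List (Fin n)} (h : b <+: c) : cylinder c ⊆ cylinder b := by
  obtain ⟨d, rfl⟩ := h
  rintro _ ⟨x, rfl⟩
  exact ⟨prepend d x, (prepend_append b d x).symm⟩

theorem cylinder_nil : cylinder ([] : List (Fin n)) = Set.univ :=
  Set.eq_univ_of_forall fun x => ⟨x, rfl⟩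

theorem cylinder_eq_iUnion (b : List (Fin n)) : cylinder b = ⋃ i, cylinder (b ++ [i]) := by
  refine Set.Subset.antisymm ?_ (Set.iUnion_subset fun i =>
    cylinder_subset_of_prefix (List.prefix_append b [i]))
  rintro _ ⟨x, rfl⟩
  refine Set.mem_iUnion.2 ⟨x 0, fun k => x (k + 1), ?_⟩
  rw [prepend_append, ← exists_eq_prepend_singleton x]

theorem disjoint_cylinder {b c : List (Fin n)} (h : b.length = c.length) (hne : b ≠ c) :
    Disjoint (cylinder b) (cylinder c) := by
  refine Set.disjoint_left.2 fun x hb hc => hne ?_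
  rw [mem_cylinder_iff] at hb hc
  exact hb.symm.trans (h ▸ hc)

theorem eventually_initialWord_ne {y z : CantorK n} (h : y ≠ z) :
    ∀ᶠ N in atTop, initialWord y N ≠ initialWord z N := by
  obtain ⟨k, hk⟩ := Function.ne_iff.1 h
  filter_upwards [eventually_gt_atTop k] with N hN e
  exact hk (List.map_inj_left.1 e k (List.mem_range.2 hN))

/-- Kőnig's lemma. -/
theorem exists_end_forall_initialWord {P : List (Fin n) → Prop} (h0 : P [])
    (hs : ∀ b, P b → ∃ i, P (b ++ [i])) : ∃ y : CantorK n, ∀ N, P (initialWord y N) := by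
  choose f hf using fun b : {b // P b} => hs b.1 b.2
  let c : ℕ → {b // P b} := Nat.rec ⟨[], h0⟩ fun _ b => ⟨b.1 ++ [f b], hf b⟩
  have hc (N : ℕ) : initialWord (fun k => f (c k)) N = (c N).1 := by
    induction N with
    | zero => rfl
    | succ N ih => rw [initialWord_succ, ih]
  exact ⟨fun k => f (c k), fun N => hc N ▸ (c N).2⟩

theorem exists_end_forall_prefix_mem {O : Set (List (Fin n))} (hO : O.Infinite) :
    ∃ y : CantorK n, ∀ N, ∃ c ∈ O, initialWord y N <+: c := by
  obtain ⟨y, hy⟩ := exists_end_forall_initialWord (P := fun b => {c | b ++ c ∈ O}.Infinite)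
    (by simpa using hO) fun b hb => by
      by_contra! h
      refine hb (((Set.finite_singleton []).union
        (Set.finite_iUnion fun i => (h i).image (List.cons i))).subset ?_)
      rintro (_ | ⟨i, c⟩) hc
      · exact Or.inl rfl
      · exact Or.inr (Set.mem_iUnion.2 ⟨i, c, by simpa using hc, rfl⟩)
  refine ⟨y, fun N => ?_⟩
  obtain ⟨c, hc⟩ := (hy N).nonempty
  exact ⟨_, hc, List.prefix_append _ c⟩

end Words

section PrefixReplacement

variable {n : ℕ} {G : Type*} [Group G] [MulAction G (CantorK n)]

/-- The element `g` maps the elementary interval below `b` onto the one below `c` by changing the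
prefix. -/
def ReplacesPrefix (g : G) (b c : List (Fin n)) : Prop :=
  ∀ x, g • prepend b x = prepend c x

variable (n) in
/-- On elementary intervals of depth at least `L` the element `g` replaces the prefix by one that is
shorter by at most `L`. -/
def LosesAtMost (L : ℕ) (g : G) : Prop :=
  ∀ b : List (Fin n), L ≤ b.length → ∃ c, ReplacesPrefix g b c ∧ b.length ≤ c.length + L

namespace ReplacesPrefix

variable {g h : G} {b c d : List (Fin n)}

theorem one (b : List (Fin n)) : ReplacesPrefix (1 : G) b b :=
  fun _ => one_smul _ _

theorem mul (hh : ReplacesPrefix h c d) (hg : ReplacesPrefix g b c) :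
    ReplacesPrefix (h * g) b d := fun x => by
  rw [mul_smul, hg x, hh x]

theorem image_cylinder (hg : ReplacesPrefix g b c) : (g • ·) '' cylinder b = cylinder c := by
  rw [cylinder, cylinder, ← Set.range_comp]
  exact congrArg Set.range (funext hg)

theorem mapsTo (hg : ReplacesPrefix g b c) : Set.MapsTo (g • ·) (cylinder b) (cylinder c) :=
  Set.mapsTo_iff_image_subset.2 hg.image_cylinder.subset

theorem mass_eq (hg : ReplacesPrefix g b c) {m : Mean (CantorK n)} (hm : m.IsInvariant G) :
    m.mass (cylinder b) = m.mass (cylinder c) := by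
  rw [← hg.image_cylinder, hm.mass_image]

end ReplacesPrefix

theorem LosesAtMost.mono {L M : ℕ} {g : G} (hg : LosesAtMost n L g) (hLM : L ≤ M) :
    LosesAtMost n M g := fun b hb => by
  obtain ⟨c, hc, hlen⟩ := hg b (hLM.trans hb)
  exact ⟨c, hc, hlen.trans (by gcongr)⟩

theorem LosesAtMost.eventually {L : ℕ} {g : G} (hg : LosesAtMost n L g) :
    ∀ᶠ M in atTop, LosesAtMost n M g :=
  eventually_atTop.2 ⟨L, fun _ => hg.mono⟩

end PrefixReplacement

section FiniteOrbit

variable {n : ℕ} {G : Type*} [Group G] [MulAction G (CantorK n)]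

theorem Mean.exists_mass_append_pos (m : Mean (CantorK n)) {b : List (Fin n)}
    (hb : 0 < m.mass (cylinder b)) : ∃ i, 0 < m.mass (cylinder (b ++ [i])) := by
  by_contra! h
  have hsum := m.mass_biUnion Finset.univ (fun i => cylinder (b ++ [i]))
    fun i _ j _ hij => disjoint_cylinder (by simp) (by simpa using hij)
  simp only [Finset.mem_univ, Set.iUnion_true, ← cylinder_eq_iUnion] at hsum
  linarith [Finset.sum_nonpos fun i (_ : i ∈ Finset.univ) => h i]

theorem Mean.finite_atoms (m : Mean (CantorK n)) {α : ℝ} (hα : 0 < α) :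
    {z : CantorK n | ∀ N, α ≤ m.mass (cylinder (initialWord z N))}.Finite := by
  by_contra hinf
  obtain ⟨r, hr⟩ := exists_nat_gt α⁻¹
  obtain ⟨s, hs, hcard⟩ := (show Set.Infinite _ from hinf).exists_subset_card_eq r
  have hsep : ∀ᶠ M in atTop, ∀ y ∈ s, ∀ z ∈ s, y ≠ z → initialWord y M ≠ initialWord z M := by
    simp only [Filter.eventually_all_finset, Filter.eventually_imp_distrib_left]
    exact fun y _ z _ => eventually_initialWord_ne
  obtain ⟨M, hM⟩ := hsep.exists
  have hdisj : (s : Set (CantorK n)).PairwiseDisjoint fun z => cylinder (initialWord z M) :=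
    fun y hy z hz hyz => disjoint_cylinder (by simp) (hM y hy z hz hyz)
  have hle : (r : ℝ) * α ≤ 1 := calc
    (r : ℝ) * α ≤ ∑ z ∈ s, m.mass (cylinder (initialWord z M)) := by
      rw [← hcard, ← nsmul_eq_mul]
      exact Finset.card_nsmul_le_sum _ _ _ fun z hz => hs hz M
    _ = m.mass (⋃ z ∈ s, cylinder (initialWord z M)) := (m.mass_biUnion s _ hdisj).symm
    _ ≤ 1 := m.mass_le_one _
  exact hle.not_gt ((inv_lt_iff_one_lt_mul₀ hα).1 hr)

theorem finite_orbit_of_atom {m : Mean (CantorK n)} (hm : m.IsInvariant G)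
    (hG : ∀ g : G, ∃ L, LosesAtMost n L g) {y : CantorK n} {α : ℝ} (hα : 0 < α)
    (hy : ∀ N, α ≤ m.mass (cylinder (initialWord y N))) : (MulAction.orbit G y).Finite := by
  refine (m.finite_atoms hα).subset ?_
  rintro _ ⟨g, rfl⟩ N
  obtain ⟨L, hL⟩ := hG g
  obtain ⟨b, hb, hlen⟩ := hL (initialWord y (N + L)) (by simp)
  rw [length_initialWord, add_le_add_iff_right] at hlen
  calc α ≤ m.mass (cylinder (initialWord y (N + L))) := hy _
    _ = m.mass (cylinder b) := hb.mass_eq hm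
    _ ≤ _ := m.mass_mono <| cylinder_subset_of_prefix <|
      initialWord_prefix_of_mem_cylinder (hb.mapsTo (mem_cylinder_initialWord _ _)) hlen

theorem exists_replacesPrefix_of_closure_eq_top {S : Set G} (hS : Subgroup.closure S = ⊤) {L : ℕ}
    (hL : ∀ g ∈ S, LosesAtMost n L g ∧ LosesAtMost n L g⁻¹) {a : List (Fin n)}
    (ha : ∀ (g : G) b, ReplacesPrefix g a b → L ≤ b.length) (g : G) :
    ∃ b, ReplacesPrefix g a b := by
  have step {s k : G} (hs : LosesAtMost n L s) (hk : ∃ b, ReplacesPrefix k a b) :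
      ∃ b, ReplacesPrefix (s * k) a b := by
    obtain ⟨b, hb⟩ := hk
    obtain ⟨c, hc, -⟩ := hs b (ha k b hb)
    exact ⟨c, hc.mul hb⟩
  have hg : g ∈ Subgroup.closure S := hS ▸ Subgroup.mem_top g
  induction hg using Subgroup.closure_induction_left with
  | one => exact ⟨a, .one a⟩
  | mul_left s hs k _ ih => exact step (hL s hs).1 ih
  | inv_mul_cancel s hs k _ ih => exact step (hL s hs).2 ih

theorem exists_finite_orbit_of_forall_replacesPrefix {m : Mean (CantorK n)} (hm : m.IsInvariant G)
    (hG : ∀ g : G, ∃ L, LosesAtMost n L g) {a : List (Fin n)} (ha : 0 < m.mass (cylinder a))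
    (h : ∀ g : G, ∃ b, ReplacesPrefix g a b) : ∃ y : CantorK n, (MulAction.orbit G y).Finite := by
  by_cases hO : {b | ∃ g : G, ReplacesPrefix g a b}.Finite
  · obtain ⟨y, x, rfl⟩ : (cylinder a).Nonempty := by
      by_contra! hempty
      rw [hempty, m.mass_empty] at ha
      exact ha.false
    refine ⟨prepend a x, (hO.image fun b => prepend b x).subset ?_⟩
    rintro _ ⟨g, rfl⟩
    obtain ⟨b, hb⟩ := h g
    exact ⟨b, ⟨g, hb⟩, (hb x).symm⟩
  · obtain ⟨z, hz⟩ := exists_end_forall_prefix_mem hO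
    refine ⟨z, finite_orbit_of_atom hm hG ha fun N => ?_⟩
    obtain ⟨b, ⟨g, hg⟩, hzb⟩ := hz N
    exact hg.mass_eq hm ▸ m.mass_mono (cylinder_subset_of_prefix hzb)

theorem Mean.exists_forall_le_mass_cylinder (m : Mean (CantorK n)) (L : ℕ) :
    ∃ δ > 0, ∀ b : List (Fin n), b.length ≤ L → 0 < m.mass (cylinder b) →
      δ ≤ m.mass (cylinder b) := by
  have hfin : {b : List (Fin n) | b.length ≤ L ∧ 0 < m.mass (cylinder b)}.Finite :=
    (List.finite_length_le _ _).subset fun b hb => hb.1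
  obtain ⟨b, hb, hmin⟩ := Set.exists_min_image _ (fun b => m.mass (cylinder b)) hfin
    ⟨[], by simp [cylinder_nil, m.mass_univ]⟩
  exact ⟨_, hb.2, fun c hc hpos => hmin c ⟨hc, hpos⟩⟩

/-- If the images of some vertex on the way to an end of positive mass stay deep, then all group
elements replace that vertex as a prefix; otherwise deep vertices on the way to the end have images
of bounded depth, and their masses are bounded below. -/
theorem exists_finite_orbit_of_invariant_mean [Group.FG G]
    (hG : ∀ g : G, ∃ L, LosesAtMost n L g) {m : Mean (CantorK n)} (hm : m.IsInvariant G) :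
    ∃ y : CantorK n, (MulAction.orbit G y).Finite := by
  obtain ⟨S, hS⟩ := Group.fg_def.1 ‹Group.FG G›
  have hev (g : G) : ∀ᶠ L in atTop, LosesAtMost n L g := (hG g).elim fun _ => LosesAtMost.eventually
  obtain ⟨L, hL⟩ := (S.eventually_all.2 fun g _ => (hev g).and (hev g⁻¹)).exists
  obtain ⟨y, hy⟩ := exists_end_forall_initialWord (P := fun b => 0 < m.mass (cylinder b))
    (by simp [cylinder_nil, m.mass_univ]) fun b hb => m.exists_mass_append_pos hb
  by_cases hdeep : ∃ N, ∀ (g : G) b, ReplacesPrefix g (initialWord y N) b → L ≤ b.length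
  · obtain ⟨N, hN⟩ := hdeep
    exact exists_finite_orbit_of_forall_replacesPrefix hm hG (hy N)
      (exists_replacesPrefix_of_closure_eq_top hS hL hN)
  · push Not at hdeep
    obtain ⟨δ, hδ, hle⟩ := m.exists_forall_le_mass_cylinder L
    refine ⟨y, finite_orbit_of_atom hm hG hδ fun N => ?_⟩
    obtain ⟨g, b, hb, hlen⟩ := hdeep N
    have hmass := hb.mass_eq hm
    exact hmass ▸ hle b hlen.le (hmass ▸ hy N)

end FiniteOrbit

open Classical in
/-- The proportion of the elements of a finite type that satisfy a predicate. -/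
noncomputable def freq {Ω : Type*} [Fintype Ω] (p : Ω → Prop) : ℝ :=
  𝔼 ω, if p ω then 1 else 0

section Freq

variable {Ω Ω' : Type*} [Fintype Ω] [Fintype Ω']

theorem freq_nonneg (p : Ω → Prop) : 0 ≤ freq p :=
  Finset.expect_nonneg fun _ _ => by split_ifs <;> simp

theorem freq_mono {p q : Ω → Prop} (h : ∀ ω, p ω → q ω) : freq p ≤ freq q := by
  refine Finset.expect_le_expect fun ω _ => ?_
  by_cases hp : p ω
  · simp [hp, h ω hp]
  · rw [if_neg hp]
    split_ifs <;> simp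

theorem freq_false : freq (fun _ : Ω => False) = 0 := by
  simp [freq]

theorem freq_true [Nonempty Ω] : freq (fun _ : Ω => True) = 1 := by
  simp [freq]

theorem freq_le_one (p : Ω → Prop) : freq p ≤ 1 := by
  obtain _ | _ := isEmpty_or_nonempty Ω
  · simp [freq]
  · exact (freq_mono fun _ _ => trivial).trans freq_true.le

theorem freq_or_le (p q : Ω → Prop) : freq (fun ω => p ω ∨ q ω) ≤ freq p + freq q := by
  rw [freq, freq, freq, ← Finset.expect_add_distrib]
  refine Finset.expect_le_expect fun ω _ => ?_
  by_cases hp : p ω <;> by_cases hq : q ω <;> simp [hp, hq]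

theorem freq_exists_le {β : Type*} (s : Finset β) (p : β → Ω → Prop) {η : ℝ}
    (h : ∀ b ∈ s, freq (p b) ≤ η) : freq (fun ω => ∃ b ∈ s, p b ω) ≤ s.card * η := by
  classical
  induction s using Finset.induction_on with
  | empty => simp [freq_false]
  | insert a s ha ih =>
    simp only [Finset.exists_mem_insert]
    rw [Finset.card_insert_of_notMem ha]
    push_cast
    linarith [freq_or_le (p a) fun ω => ∃ b ∈ s, p b ω, h a (Finset.mem_insert_self a s),
      ih fun b hb => h b (Finset.mem_insert_of_mem hb)]

theorem exists_not_of_freq_lt_one [Nonempty Ω] {p : Ω → Prop} (h : freq p < 1) :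
    ∃ ω, ¬ p ω := by
  by_contra! hp
  exact h.not_ge (freq_true.ge.trans (freq_mono fun ω _ => hp ω))

theorem freq_comp_equiv (e : Ω ≃ Ω') (p : Ω' → Prop) : freq (fun ω => p (e ω)) = freq p :=
  Fintype.expect_equiv e _ _ fun _ => rfl

theorem freq_prod (p : Ω × Ω' → Prop) : freq p = 𝔼 a, freq fun b => p (a, b) := by
  rw [freq, ← Finset.univ_product_univ, Finset.expect_product]
  rfl

theorem freq_prod_le_add {p : Ω × Ω' → Prop} {q : Ω → Prop} {η ε : ℝ} (hε : 0 ≤ ε)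
    (hq : ∀ a, q a → freq (fun b => p (a, b)) ≤ η)
    (hnq : ∀ a, ¬ q a → freq (fun b => p (a, b)) ≤ ε) : freq p ≤ freq q * η + ε := by
  obtain _ | _ := isEmpty_or_nonempty Ω
  · simpa [freq] using hε
  rw [freq_prod, freq, Finset.expect_mul, ← Finset.expect_const (Finset.univ_nonempty (α := Ω)) ε,
    ← Finset.expect_add_distrib]
  refine Finset.expect_le_expect fun a _ => ?_
  by_cases ha : q a
  · simpa [ha] using (hq a ha).trans (le_add_of_nonneg_right hε)
  · simpa [ha] using hnq a ha

theorem freq_prod_le {p : Ω × Ω' → Prop} {ε : ℝ} (hε : 0 ≤ ε)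
    (h : ∀ a, freq (fun b => p (a, b)) ≤ ε) : freq p ≤ ε := by
  simpa using freq_prod_le_add (η := 0) hε (fun _ => False.elim) fun a _ => h a

variable {κ : Type*} [Fintype κ]

theorem freq_pi_le [DecidableEq κ] {p : Ω → Ω → Prop} {η : ℝ} (hη : 0 ≤ η) (h : ∀ a, freq (p a) ≤ η)
    {i j : κ} (hij : i ≠ j) : freq (fun w : κ → Ω => p (w i) (w j)) ≤ η := by
  let e := (Equiv.funSplitAt j Ω).trans (Equiv.prodComm _ _)
  have he : (fun w : κ → Ω => p (w i) (w j)) = fun w => p ((e w).1 ⟨i, hij⟩) (e w).2 := by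
    funext w
    simp [e, Equiv.funSplitAt, Equiv.piSplitAt]
  rw [he, freq_comp_equiv e fun x => p (x.1 ⟨i, hij⟩) x.2]
  exact freq_prod_le hη fun a => h _

/-- The union bound over the pairs of distinct indices. -/
theorem exists_pairwise_of_freq_not_le [Nonempty Ω] {R : Ω → Ω → Prop} {η : ℝ} (hη : 0 ≤ η)
    (h : ∀ a, freq (fun b => ¬ R a b) ≤ η) (hκ : (Fintype.card κ : ℝ) ^ 2 * η < 1) :
    ∃ w : κ → Ω, Pairwise fun i j => R (w i) (w j) := by
  classical
  obtain ⟨w, hw⟩ : ∃ w : κ → Ω, ¬ ∃ x ∈ Finset.univ.offDiag, ¬ R (w x.1) (w x.2) := by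
    refine exists_not_of_freq_lt_one (lt_of_le_of_lt (freq_exists_le _
      (fun (x : κ × κ) (w : κ → Ω) => ¬ R (w x.1) (w x.2)) fun x hx =>
        freq_pi_le hη h (Finset.mem_offDiag.1 hx).2.2) (lt_of_le_of_lt ?_ hκ))
    gcongr
    exact_mod_cast (Finset.offDiag_card _).trans_le (by simp [sq])
  push Not at hw
  exact ⟨w, fun i j hij => hw (i, j) (by simpa using hij)⟩

end Freq

section WordProd

variable {G ι : Type*} [Group G]

/-- The product in a group of a word in the letters `S i`. -/
def wordProd (S : ι → G) {k : ℕ} (w : Fin k → ι) : G :=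
  (List.ofFn fun j => S (w j)).prod

theorem wordProd_zero (S : ι → G) (w : Fin 0 → ι) : wordProd S w = 1 := by
  simp [wordProd]

theorem wordProd_cons (S : ι → G) {k : ℕ} (i : ι) (w : Fin k → ι) :
    wordProd S (Fin.cons i w : Fin (k + 1) → ι) = S i * wordProd S w := by
  simp [wordProd, List.ofFn_succ]

theorem wordProd_append (S : ι → G) {j k : ℕ} (v : Fin j → ι) (w : Fin k → ι) :
    wordProd S (Fin.append v w) = wordProd S v * wordProd S w := by
  have h : (fun i => S (Fin.append v w i)) = Fin.append (S ∘ v) (S ∘ w) := by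
    funext i
    refine Fin.addCases (fun i => ?_) (fun i => ?_) i <;> simp
  rw [wordProd, h, List.ofFn_fin_append, List.prod_append]
  rfl

theorem wordProd_rev (S : ι → G) {σ : ι → ι} (hσ : ∀ i, S (σ i) = (S i)⁻¹) {k : ℕ}
    (w : Fin k → ι) : wordProd S (fun j => σ (w j.rev)) = (wordProd S w)⁻¹ := by
  rw [wordProd, wordProd, List.prod_inv_reverse, List.map_ofFn]
  congr 1
  refine List.ext_getElem (by simp) fun i _ hi => ?_
  simp only [List.length_reverse, List.length_ofFn] at hi
  simp only [List.getElem_ofFn, List.getElem_reverse, List.length_ofFn, Function.comp_apply, hσ]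
  congr 3
  ext
  simp only [Fin.val_rev]
  lia

variable [Fintype ι]

theorem freq_cons {k : ℕ} (p : (Fin (k + 1) → ι) → Prop) :
    freq p = freq fun x : ι × (Fin k → ι) => p (Fin.cons x.1 x.2) :=
  (freq_comp_equiv (Fin.consEquiv fun _ => ι) p).symm

theorem freq_append {j k : ℕ} (p : (Fin (j + k) → ι) → Prop) :
    freq p = freq fun x : (Fin k → ι) × (Fin j → ι) => p (Fin.append x.2 x.1) :=
  (freq_comp_equiv ((Equiv.prodComm _ _).trans (Fin.appendEquiv j k)) p).symm

variable {Ω : Type*} [MulAction G Ω]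

theorem EllTwo.average_pow_single_apply [DecidableEq Ω] (S : ι → G) (k : ℕ) (x y : Ω) :
    ((average S ^ k) (lp.single 2 x (1 : ℝ)) : EllTwo Ω) y =
      freq fun w : Fin k → ι => wordProd S w • x = y := by
  induction k generalizing y with
  | zero => by_cases h : x = y <;> simp [freq, wordProd_zero, h, eq_comm]
  | succ k ih =>
    rw [pow_succ', mul_apply_eq_comp, average_apply, freq_cons, freq_prod,
      Fintype.expect_eq_sum_div_card, div_eq_inv_mul, lp.coeFn_smul, lp.coeFn_sum, Pi.smul_apply,
      Finset.sum_apply, smul_eq_mul]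
    simp only [translate_apply, ih, wordProd_cons, mul_smul, eq_inv_smul_iff]

theorem freq_wordProd_smul_eq_le (S : ι → G) (k : ℕ) (x y : Ω) :
    freq (fun w : Fin k → ι => wordProd S w • x = y) ≤
      ‖(EllTwo.average S : EllTwo Ω →L[ℝ] EllTwo Ω)‖ ^ k := by
  classical
  let T : EllTwo Ω →L[ℝ] EllTwo Ω := EllTwo.average S
  let δ : EllTwo Ω := lp.single 2 x 1
  have hδ : ‖δ‖ = 1 := by simp [δ, lp.norm_single]
  have : Nontrivial (EllTwo Ω) := nontrivial_of_ne δ 0 (norm_ne_zero_iff.1 (by simp [hδ]))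
  calc freq (fun w : Fin k → ι => wordProd S w • x = y)
      = (T ^ k) δ y := (EllTwo.average_pow_single_apply S k x y).symm
    _ ≤ ‖(T ^ k) δ‖ := (Real.le_norm_self _).trans (lp.norm_apply_le_norm two_ne_zero _ y)
    _ ≤ ‖T ^ k‖ * ‖δ‖ := (T ^ k).le_opNorm δ
    _ = ‖T ^ k‖ := by rw [hδ, mul_one]
    _ ≤ ‖T‖ ^ k := norm_pow_le _ _

end WordProd

section Contraction

variable {n : ℕ} {G : Type*} [Group G] [MulAction G (CantorK n)]

theorem LosesAtMost.one : LosesAtMost n 0 (1 : G) :=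
  fun b _ => ⟨b, .one b, le_rfl⟩

theorem LosesAtMost.mul {K L : ℕ} {g h : G} (hg : LosesAtMost n K g) (hh : LosesAtMost n L h) :
    LosesAtMost n (K + L) (g * h) := fun b hb => by
  obtain ⟨c, hc, hbc⟩ := hh b (by lia)
  obtain ⟨d, hd, hcd⟩ := hg c (by lia)
  exact ⟨d, hd.mul hc, by lia⟩

/-- The element `g` maps the elementary interval below `b` onto one of depth at least `l`, by
replacing the prefix. -/
def MapsDeep (g : G) (b : List (Fin n)) (l : ℕ) : Prop :=
  ∃ c, ReplacesPrefix g b c ∧ l ≤ c.length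

theorem LosesAtMost.mapsDeep {L l : ℕ} {g : G} (hg : LosesAtMost n L g) {b : List (Fin n)}
    (hb : l + L ≤ b.length) : MapsDeep g b l := by
  obtain ⟨c, hc, hlen⟩ := hg b (by lia)
  exact ⟨c, hc, by lia⟩

variable (n) in
/-- The vertices of depth less than `r`. -/
noncomputable def shallow (r : ℕ) : Finset (List (Fin n)) :=
  (List.finite_length_lt (Fin n) r).toFinset

theorem mem_shallow {r : ℕ} {b : List (Fin n)} : b ∈ shallow n r ↔ b.length < r := by
  simp [shallow]

theorem ReplacesPrefix.mapsDeep_or {g : G} {b c : List (Fin n)} (hg : ReplacesPrefix g b c)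
    (l : ℕ) : MapsDeep g b l ∨ ∃ c ∈ shallow n l, ReplacesPrefix g b c :=
  (le_or_gt l c.length).imp (fun hl => ⟨c, hg, hl⟩) fun hl => ⟨c, mem_shallow.2 hl, hg⟩

theorem MapsDeep.mul_or {L : ℕ} {g h : G} {b : List (Fin n)} (hg : LosesAtMost n L g)
    (hh : MapsDeep h b L) :
    MapsDeep (g * h) b L ∨ ∃ c ∈ shallow n L, ReplacesPrefix (g * h) b c := by
  obtain ⟨c, hc, hlen⟩ := hh
  obtain ⟨d, hd, -⟩ := hg c hlen
  exact (hd.mul hc).mapsDeep_or L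

variable {ι : Type*} {S : ι → G} {L : ℕ}

theorem losesAtMost_wordProd (hL : ∀ i, LosesAtMost n L (S i)) {k : ℕ} (w : Fin k → ι) :
    LosesAtMost n (k * L) (wordProd S w) := by
  induction k with
  | zero => simpa [wordProd_zero] using LosesAtMost.one
  | succ k ih =>
    induction w using Fin.consCases with
    | _ i w =>
      rw [wordProd_cons, add_one_mul, add_comm]
      exact (hL i).mul (ih w)

variable [Fintype ι] {ρ : ℝ}

variable (n) in
/-- The probability that a random word of length `k` replaces one given prefix by another decays
like `ρ ^ k`. -/
def ReplacementDecay (S : ι → G) (ρ : ℝ) : Prop :=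
  ∀ (k : ℕ) (b c : List (Fin n)),
    freq (fun w : Fin k → ι => ReplacesPrefix (wordProd S w) b c) ≤ ρ ^ k

theorem freq_not_mapsDeep_succ_le (hL : ∀ i, LosesAtMost n L (S i))
    (hρ : ReplacementDecay n S ρ) (k : ℕ) (b : List (Fin n)) :
    freq (fun w : Fin (k + 1) → ι => ¬ MapsDeep (wordProd S w) b L) ≤
      freq (fun w : Fin k → ι => ¬ MapsDeep (wordProd S w) b L) +
        (shallow n L).card * ρ ^ (k + 1) := by
  have hshallow : freq (fun w : Fin (k + 1) → ι =>
      ∃ c ∈ shallow n L, ReplacesPrefix (wordProd S w) b c) ≤ (shallow n L).card * ρ ^ (k + 1) :=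
    freq_exists_le _ _ fun c _ => hρ _ b c
  rw [freq_cons] at hshallow ⊢
  refine (freq_mono fun x hx => ?_).trans ((freq_or_le _ _).trans (add_le_add
    (freq_prod_le (p := fun x : ι × (Fin k → ι) => ¬ MapsDeep (wordProd S x.2) b L)
      (freq_nonneg _) fun _ => le_rfl) hshallow))
  by_contra! h
  rw [wordProd_cons] at hx h
  obtain ⟨c, hc, hxc⟩ := (h.1.mul_or (hL x.1)).resolve_left hx
  exact h.2 c hc hxc

theorem freq_not_mapsDeep_add_le (hL : ∀ i, LosesAtMost n L (S i)) (h0 : 0 ≤ ρ) (h1 : ρ < 1)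
    (hρ : ReplacementDecay n S ρ) {J : ℕ} {b : List (Fin n)} (hb : L + J * L ≤ b.length) (t : ℕ) :
    freq (fun w : Fin (J + t) → ι => ¬ MapsDeep (wordProd S w) b L) ≤
      (shallow n L).card * (1 - ρ)⁻¹ * ρ ^ J := by
  have hsum : freq (fun w : Fin (J + t) → ι => ¬ MapsDeep (wordProd S w) b L) ≤
      (shallow n L).card * ρ ^ (J + 1) * ∑ j ∈ Finset.range t, ρ ^ j := by
    induction t with
    | zero => simp [(losesAtMost_wordProd hL _).mapsDeep hb, freq_false]
    | succ t ih =>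
      refine (freq_not_mapsDeep_succ_le hL hρ (J + t) b).trans ?_
      rw [Finset.sum_range_succ, mul_add]
      exact add_le_add ih (by rw [mul_assoc, ← pow_add, add_right_comm])
  calc freq (fun w : Fin (J + t) → ι => ¬ MapsDeep (wordProd S w) b L)
      ≤ (shallow n L).card * ρ ^ (J + 1) * ∑ j ∈ Finset.range t, ρ ^ j := hsum
    _ ≤ (shallow n L).card * ρ ^ J * (1 - ρ)⁻¹ := by
      rw [← tsum_geometric_of_lt_one h0 h1]
      have hpow := pow_le_pow_of_le_one h0 h1.le (Nat.le_succ J)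
      have hgeom := (summable_geometric_of_lt_one h0 h1).sum_le_tsum (Finset.range t)
        fun j _ => pow_nonneg h0 j
      exact mul_le_mul (mul_le_mul_of_nonneg_left hpow (Nat.cast_nonneg _)) hgeom
        (Finset.sum_nonneg fun j _ => pow_nonneg h0 j) (by positivity)
    _ = (shallow n L).card * (1 - ρ)⁻¹ * ρ ^ J := mul_right_comm _ _ _

/-- A walk that starts deep stays deep for `J` steps, and the probabilities of getting shallow later
have a small sum. -/
theorem exists_freq_not_mapsDeep_le (hL : ∀ i, LosesAtMost n L (S i)) (h0 : 0 ≤ ρ) (h1 : ρ < 1)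
    (hρ : ReplacementDecay n S ρ) {η : ℝ} (hη : 0 < η) :
    ∃ N : ℕ, ∀ l : ℕ, ∀ᶠ k in atTop, ∀ b : List (Fin n), N ≤ b.length →
      freq (fun w : Fin k → ι => ¬ MapsDeep (wordProd S w) b l) ≤ η := by
  have hlim (C : ℝ) : ∀ᶠ k in atTop, C * ρ ^ k ≤ η / 2 := by
    have h := (tendsto_pow_atTop_nhds_zero_of_lt_one h0 h1).const_mul C
    rw [mul_zero] at h
    exact h.eventually_le_const (half_pos hη)
  obtain ⟨J, hJ⟩ := (hlim ((shallow n L).card * (1 - ρ)⁻¹)).exists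
  refine ⟨L + J * L, fun l => ?_⟩
  filter_upwards [hlim (shallow n l).card, eventually_ge_atTop J] with k hk hJk b hb
  obtain ⟨t, rfl⟩ := Nat.exists_eq_add_of_le hJk
  have hnever := freq_not_mapsDeep_add_le hL h0 h1 hρ hb t
  have hshallow := freq_exists_le (shallow n l)
    (fun c (w : Fin (J + t) → ι) => ReplacesPrefix (wordProd S w) b c) fun c _ => hρ _ b c
  refine (freq_mono fun w hw => ?_).trans ((freq_or_le (fun w => ¬ MapsDeep (wordProd S w) b L)
    (fun w => ∃ c ∈ shallow n l, ReplacesPrefix (wordProd S w) b c)).trans (by linarith))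
  refine or_iff_not_imp_left.2 fun hdeep => ?_
  obtain ⟨c, hc, -⟩ := not_not.1 hdeep
  exact (hc.mapsDeep_or l).resolve_left hw

end Contraction

section Capture

variable {n : ℕ} {G : Type*} [Group G] [MulAction G (CantorK n)]

/-- The element `g` maps the elementary interval below `c` into the union of those below the
vertices in `D`. -/
def IsCaptured (g : G) (c : List (Fin n)) (D : Finset (List (Fin n))) : Prop :=
  Set.MapsTo (g • ·) (cylinder c) (⋃ b ∈ D, cylinder b)

theorem IsCaptured.mono {g : G} {b c : List (Fin n)} {D E : Finset (List (Fin n))}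
    (hg : IsCaptured g b D) (hbc : b <+: c) (hDE : D ⊆ E) : IsCaptured g c E :=
  Set.MapsTo.mono hg (cylinder_subset_of_prefix hbc) (Set.biUnion_subset_biUnion_left hDE)

theorem IsCaptured.mul {g h : G} {b c : List (Fin n)} {D : Finset (List (Fin n))}
    (hh : IsCaptured h c D) (hg : ReplacesPrefix g b c) : IsCaptured (h * g) b D := fun x hx => by
  simpa only [mul_smul] using hh (hg.mapsTo hx)

theorem MapsDeep.mul {g h : G} {b c : List (Fin n)} {l : ℕ} (hh : MapsDeep h c l)
    (hg : ReplacesPrefix g b c) : MapsDeep (h * g) b l := by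
  obtain ⟨d, hd, hl⟩ := hh
  exact ⟨d, hd.mul hg, hl⟩

theorem MapsDeep.isCaptured {g : G} {b : List (Fin n)} {l : ℕ} (h : MapsDeep g b l) :
    ∃ c : List (Fin n), c.length = l ∧ IsCaptured g b {c} := by
  obtain ⟨c, hc, hl⟩ := h
  refine ⟨c.take l, by simpa using hl, fun x hx => ?_⟩
  simpa using cylinder_subset_of_prefix (List.take_prefix l c) (hc.mapsTo hx)

theorem exists_finset_isCaptured (g : G) (B : Finset (List (Fin n))) (l : ℕ) :
    ∃ D : Finset (List (Fin n)), D.card ≤ B.card ∧ (∀ c ∈ D, c.length = l) ∧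
      ∀ b ∈ B, MapsDeep g b l → IsCaptured g b D := by
  classical
  choose f hlen hf using fun b : {b : List (Fin n) // MapsDeep g b l} => b.2.isCaptured
  refine ⟨(B.subtype fun b => MapsDeep g b l).image f, ?_, by grind, fun b hb hdeep => ?_⟩
  · exact Finset.card_image_le.trans
      ((Finset.card_subtype _ _).trans_le (Finset.card_filter_le _ _))
  · refine (hf ⟨b, hdeep⟩).mono List.prefix_rfl (Finset.singleton_subset_iff.2 ?_)
    exact Finset.mem_image_of_mem f (Finset.mem_subtype.2 hb)

variable {ι : Type*} [Fintype ι]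

variable (n) in
/-- For every `l`, long random words map each sufficiently deep elementary interval, with
probability at least `1 - η`, into `d` elementary intervals of depth `l` that depend on the word
only. -/
def Captures (S : ι → G) (η : ℝ) (d : ℕ) : Prop :=
  ∃ M : ℕ, ∀ l : ℕ, ∀ᶠ k in atTop, ∃ D : (Fin k → ι) → Finset (List (Fin n)),
    (∀ w, (D w).card ≤ d) ∧ (∀ w, ∀ b ∈ D w, b.length = l) ∧
      ∀ c, M ≤ c.length → freq (fun w => ¬ IsCaptured (wordProd S w) c (D w)) ≤ η

theorem captures_one_zero (S : ι → G) : Captures n S 1 0 :=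
  ⟨0, fun _ => .of_forall fun _ => ⟨fun _ => ∅, by simp, by simp, fun _ _ => freq_le_one _⟩⟩

variable {S : ι → G} {L : ℕ} {ρ : ℝ}

/-- Split a long word as `u v` with `v` of fixed length `τ`. If `v` maps `b` deep, then so does
`u v` with probability `1 - ε`; otherwise `v` still maps `c` to a vertex that `u` captures with
probability `1 - η`. -/
theorem freq_not_isCaptured_append_le (hL : ∀ i, LosesAtMost n L (S i)) {j τ M N l : ℕ}
    {η ε : ℝ} (hη : 0 ≤ η) (hε : 0 ≤ ε) {b c : List (Fin n)} (hbc : b <+: c)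
    (hc : M + τ * L ≤ c.length)
    (hb : freq (fun v : Fin τ → ι => ¬ MapsDeep (wordProd S v) b N) ≤ 1 / 2)
    (hdeep : ∀ b : List (Fin n), N ≤ b.length →
      freq (fun u : Fin j → ι => ¬ MapsDeep (wordProd S u) b l) ≤ ε)
    {E : (Fin j → ι) → Finset (List (Fin n))}
    (hE : ∀ c, M ≤ c.length → freq (fun u => ¬ IsCaptured (wordProd S u) c (E u)) ≤ η)
    {D : (Fin (j + τ) → ι) → Finset (List (Fin n))} (hED : ∀ u v, E u ⊆ D (Fin.append u v))
    (hD : ∀ w, MapsDeep (wordProd S w) b l → IsCaptured (wordProd S w) b (D w)) :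
    freq (fun w => ¬ IsCaptured (wordProd S w) c (D w)) ≤ 1 / 2 * η + ε := by
  rw [freq_append]
  refine (freq_prod_le_add (q := fun v => ¬ MapsDeep (wordProd S v) b N) (η := η) hε
    (fun v _ => ?_) fun v hv => ?_).trans (by gcongr)
  · obtain ⟨c', hc', hlen⟩ := (losesAtMost_wordProd hL v).mapsDeep hc
    refine (freq_mono fun u hu hcap => hu ?_).trans (hE c' hlen)
    rw [wordProd_append]
    exact (hcap.mul hc').mono List.prefix_rfl (hED u v)
  · obtain ⟨b', hb', hlen⟩ := not_not.1 hv
    refine (freq_mono fun u hu hdeep => hu ?_).trans (hdeep b' hlen)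
    refine (hD _ ?_).mono hbc subset_rfl
    rw [wordProd_append]
    exact hdeep.mul hb'

theorem exists_captures_step (hL : ∀ i, LosesAtMost n L (S i)) (h0 : 0 ≤ ρ) (h1 : ρ < 1)
    (hρ : ReplacementDecay n S ρ) :
    ∃ d₀ : ℕ, ∀ (η : ℝ) (d : ℕ), 0 < η → Captures n S η d →
      Captures n S (3 / 4 * η) (d + d₀) := by
  classical
  obtain ⟨N₀, hN₀⟩ := exists_freq_not_mapsDeep_le hL h0 h1 hρ one_half_pos
  let cells := (List.finite_length_eq (Fin n) N₀).toFinset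
  refine ⟨cells.card, ?_⟩
  rintro η d hη ⟨M, hM⟩
  have hη4 : 0 < 1 / 4 * η := by positivity
  obtain ⟨N, hN⟩ := exists_freq_not_mapsDeep_le hL h0 h1 hρ hη4
  obtain ⟨τ, hτ⟩ := (hN₀ N).exists
  refine ⟨max N₀ (M + τ * L), fun l => ?_⟩
  rw [← map_add_atTop_eq_nat τ, eventually_map]
  filter_upwards [hM l, hN l] with j ⟨E, hEcard, hElen, hE⟩ hdeep
  choose F hFcard hFlen hF using fun g : G => exists_finset_isCaptured g cells l
  refine ⟨fun w => E (fun i => w (Fin.castAdd τ i)) ∪ F (wordProd S w), fun w => ?_,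
    fun w b hb => ?_, fun c hc => ?_⟩
  · exact (Finset.card_union_le _ _).trans (add_le_add (hEcard _) (hFcard _))
  · exact (Finset.mem_union.1 hb).elim (hElen _ b) (hFlen _ b)
  · have hlen : (c.take N₀).length = N₀ :=
      List.length_take_of_le ((le_max_left _ _).trans hc)
    refine (freq_not_isCaptured_append_le hL hη.le hη4.le (List.take_prefix N₀ c)
      ((le_max_right _ _).trans hc) (hτ _ hlen.ge) hdeep hE (fun u v => ?_)
      fun w hw => ?_).trans_eq (by ring)
    · simp
    · refine (hF _ _ ?_ hw).mono List.prefix_rfl Finset.subset_union_right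
      simpa [cells] using hlen

theorem exists_captures (hL : ∀ i, LosesAtMost n L (S i)) (h0 : 0 ≤ ρ) (h1 : ρ < 1)
    (hρ : ReplacementDecay n S ρ) {ε : ℝ} (hε : 0 < ε) :
    ∃ (η : ℝ) (d : ℕ), 0 ≤ η ∧ (d + 1) * η < ε ∧ Captures n S η d := by
  obtain ⟨d₀, hd₀⟩ := exists_captures_step hL h0 h1 hρ
  have hcap (J : ℕ) : Captures n S ((3 / 4) ^ J) (J * d₀) := by
    induction J with
    | zero => simpa using captures_one_zero S
    | succ J ih =>
      rw [pow_succ', add_one_mul]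
      exact hd₀ _ _ (by positivity) ih
  have hlim : Tendsto (fun J : ℕ => (((J * d₀ : ℕ) : ℝ) + 1) * (3 / 4) ^ J) atTop (𝓝 0) := by
    have h := ((tendsto_self_mul_const_pow_of_lt_one (r := (3 / 4 : ℝ)) (by norm_num)
      (by norm_num)).const_mul (d₀ : ℝ)).add (tendsto_pow_atTop_nhds_zero_of_lt_one
        (r := (3 / 4 : ℝ)) (by norm_num) (by norm_num))
    rw [mul_zero, add_zero] at h
    refine h.congr fun J => ?_
    push_cast
    ring
  obtain ⟨J, hJ⟩ := (hlim.eventually_lt_const hε).exists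
  exact ⟨_, J * d₀, by positivity, hJ, hcap J⟩

end Capture

section PingPong

variable {α G X : Type*} [Group G] [MulAction G X]

/-- Unlike in the classical ping-pong lemma, the sets `P l` need not be disjoint; a base point
outside all of them takes the place of disjointness. -/
theorem injective_lift_of_base_point (a : α → G) (P : α × Bool → Set X)
    (h : ∀ l l' : α × Bool, (l.1 = l'.1 → l.2 = l'.2) →
      Set.MapsTo ((bif l.2 then a l.1 else (a l.1)⁻¹) • ·) (P l') (P l))
    {x₀ : X} (h₀ : ∀ l, (bif l.2 then a l.1 else (a l.1)⁻¹) • x₀ ∈ P l) (hx₀ : ∀ l, x₀ ∉ P l) :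
    Function.Injective (FreeGroup.lift a) := by
  have hmem (l : α × Bool) (T : List (α × Bool)) (hT : FreeGroup.IsReduced (l :: T)) :
      ((l :: T).map fun l => bif l.2 then a l.1 else (a l.1)⁻¹).prod • x₀ ∈ P l := by
    induction T generalizing l with
    | nil => simpa using h₀ l
    | cons l' T ih =>
      obtain ⟨hl, hT⟩ := List.isChain_cons_cons.1 hT
      rw [List.map_cons, List.prod_cons, mul_smul]
      exact h l l' hl (ih l' hT)
  classical
  refine (injective_iff_map_eq_one _).2 fun x hx => ?_
  have hred : FreeGroup.IsReduced x.toWord := FreeGroup.isReduced_toWord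
  rw [← FreeGroup.mk_toWord (x := x), FreeGroup.lift_mk] at hx
  rcases hw : x.toWord with _ | ⟨l, T⟩
  · exact FreeGroup.toWord_eq_nil_iff.1 hw
  · rw [hw] at hx hred
    have hx₀l := hmem l T hred
    rw [hx, one_smul] at hx₀l
    exact (hx₀ l hx₀l).elim

theorem injective_lift_of_mapsTo (g : α × Bool → G) (A B : α × Bool → Set X)
    (hA : Pairwise fun l' l => Set.MapsTo (g l • ·) (B l') (A l))
    (hB : Pairwise fun l' l => Set.MapsTo ((g l)⁻¹ • ·) (A l') (B l))
    {x₀ : X} (h₀ : ∀ l, (g l)⁻¹ • x₀ ∈ B l) (hx₀ : ∀ l, x₀ ∉ A l) :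
    Function.Injective (FreeGroup.lift fun i => g (i, true) * (g (i, false))⁻¹) := by
  have hletter (l : α × Bool) :
      (bif l.2 then g (l.1, true) * (g (l.1, false))⁻¹
        else (g (l.1, true) * (g (l.1, false))⁻¹)⁻¹) = g l * (g (l.1, !l.2))⁻¹ := by
    rcases l with ⟨i, _ | _⟩ <;> simp
  have hne (l : α × Bool) : (l.1, !l.2) ≠ l := by simp [Prod.ext_iff]
  refine injective_lift_of_base_point _ A (fun l l' hl x hx => ?_) (fun l => ?_) hx₀
  · have hl' : l' ≠ (l.1, !l.2) := by
      rintro rfl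
      simp at hl
    simpa only [hletter, mul_smul] using hA (hne l) (hB hl' hx)
  · simpa only [hletter, mul_smul] using hA (hne l) (h₀ _)

end PingPong

section Free

variable {n : ℕ}

theorem exists_mem_cylinder_forall_notMem (hn : 2 ≤ n) (c : List (Fin n)) {m : ℕ}
    (F : Finset (List (Fin n))) (hF : F.card ≤ m) (hlen : ∀ b ∈ F, b.length = c.length + m) :
    ∃ x ∈ cylinder c, ∀ b ∈ F, x ∉ cylinder b := by
  obtain ⟨v, hv⟩ : ∃ v : Fin m → Fin n, c ++ List.ofFn v ∉ F := by
    by_contra! h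
    have hcard : Fintype.card (Fin m → Fin n) ≤ F.card :=
      Finset.card_le_card_of_injOn (s := Finset.univ) (fun v => c ++ List.ofFn v)
        (fun v _ => h v) fun v _ w _ hvw => List.ofFn_injective (List.append_cancel_left hvw)
    rw [Fintype.card_fun, Fintype.card_fin, Fintype.card_fin] at hcard
    exact (Nat.lt_pow_self (n := m) hn).not_ge (hcard.trans hF)
  have hx : prepend (c ++ List.ofFn v) (fun _ => ⟨0, by lia⟩) ∈ cylinder (c ++ List.ofFn v) :=
    ⟨_, rfl⟩
  refine ⟨_, cylinder_subset_of_prefix (List.prefix_append c _) hx, fun b hb hxb => ?_⟩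
  refine (disjoint_cylinder ?_ ?_).notMem_of_mem_left hxb hx
  · rw [hlen b hb, List.length_append, List.length_ofFn]
  · exact ne_of_mem_of_not_mem hb hv

variable {G ι : Type*} [Group G] [MulAction G (CantorK n)] [Fintype ι] {S : ι → G} {η : ℝ}

theorem freq_not_forall_isCaptured_le {M k : ℕ} {D : (Fin k → ι) → Finset (List (Fin n))}
    (hD : ∀ c, M ≤ c.length → freq (fun w => ¬ IsCaptured (wordProd S w) c (D w)) ≤ η)
    (e : Equiv.Perm (Fin k → ι)) {s : Finset (List (Fin n))} (hs : ∀ b ∈ s, M ≤ b.length) :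
    freq (fun w => ¬ ∀ b ∈ s, IsCaptured (wordProd S (e w)) b (D (e w))) ≤ s.card * η := by
  push Not
  refine freq_exists_le s _ fun b hb => ?_
  exact (freq_comp_equiv e fun w => ¬ IsCaptured (wordProd S w) b (D w)).trans_le (hD b (hs b hb))

theorem exists_pairwise_forall_isCaptured [Nonempty ι] {κ : Type*} [Fintype κ] {M k d : ℕ}
    (hη : 0 ≤ η) (hκ : (Fintype.card κ : ℝ) ^ 2 * (2 * ((d + 1) * η)) < 1)
    {D : (Fin k → ι) → Finset (List (Fin n))} (hcard : ∀ w, (D w).card ≤ d)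
    (hlen : ∀ w, ∀ b ∈ D w, M ≤ b.length)
    (hD : ∀ c, M ≤ c.length → freq (fun w => ¬ IsCaptured (wordProd S w) c (D w)) ≤ η)
    (V : Equiv.Perm (Fin k → ι)) {c₀ : List (Fin n)} (hc₀ : M ≤ c₀.length) :
    ∃ w : κ → Fin k → ι, Pairwise fun i j =>
      (∀ b ∈ D (V (w i)), IsCaptured (wordProd S (w j)) b (D (w j))) ∧
        ∀ b ∈ insert c₀ (D (w i)), IsCaptured (wordProd S (V (w j))) b (D (V (w j))) := by
  refine exists_pairwise_of_freq_not_le (R := fun v w =>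
    (∀ b ∈ D (V v), IsCaptured (wordProd S w) b (D w)) ∧
      ∀ b ∈ insert c₀ (D v), IsCaptured (wordProd S (V w)) b (D (V w)))
    (by positivity) (fun v => ?_) hκ
  have hfst := freq_not_forall_isCaptured_le hD (Equiv.refl _) (hlen (V v))
  have hsnd := freq_not_forall_isCaptured_le hD V (s := insert c₀ (D v))
    (Finset.forall_mem_insert _ _ _ |>.2 ⟨hc₀, hlen v⟩)
  have hfst_card : ((D (V v)).card : ℝ) ≤ d + 1 := by
    exact_mod_cast (hcard _).trans (Nat.le_succ d)
  have hsnd_card : ((insert c₀ (D v)).card : ℝ) ≤ d + 1 := by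
    exact_mod_cast (Finset.card_insert_le _ _).trans (Nat.succ_le_succ (hcard v))
  simp only [not_and_or]
  refine (freq_or_le _ _).trans ((add_le_add hfst hsnd).trans ?_)
  rw [two_mul]
  gcongr

theorem exists_injective_freeGroup_of_captures {α : Type*} [Fintype α] [Nonempty ι] (hn : 2 ≤ n)
    (σ : Equiv.Perm ι) (hσ : ∀ i, S (σ i) = (S i)⁻¹) {d : ℕ} (hη : 0 ≤ η)
    (hd : (Fintype.card (α × Bool) : ℝ) ^ 2 * (2 * ((d + 1) * η)) < 1) (h : Captures n S η d) :
    ∃ φ : FreeGroup α →* G, Function.Injective φ := by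
  classical
  obtain ⟨M, hM⟩ := h
  let m := Fintype.card (α × Bool) * d
  obtain ⟨k, D, hcard, hlen, hD⟩ := (hM (M + m)).exists
  let c₀ : List (Fin n) := List.replicate M ⟨0, by lia⟩
  have hc₀ : c₀.length = M := List.length_replicate
  let V : Equiv.Perm (Fin k → ι) := Equiv.arrowCongr Fin.revPerm σ
  have hV (w : Fin k → ι) : (wordProd S w)⁻¹ = wordProd S (V w) := (wordProd_rev S hσ w).symm
  obtain ⟨w, hw⟩ := exists_pairwise_forall_isCaptured (κ := α × Bool) hη hd hcard
    (fun w b hb => (hlen w b hb).ge.trans' (Nat.le_add_right M m)) hD V hc₀.ge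
  obtain ⟨x₀, hx₀, hx₀D⟩ := exists_mem_cylinder_forall_notMem hn c₀ (m := m)
    (Finset.univ.biUnion fun l => D (w l))
    (Finset.card_biUnion_le_card_mul _ _ d fun l _ => hcard (w l)) fun b hb => by
      obtain ⟨l, -, hb⟩ := Finset.mem_biUnion.1 hb
      rw [hlen _ b hb, hc₀]
  refine ⟨_, injective_lift_of_mapsTo (fun l => wordProd S (w l))
    (fun l => ⋃ b ∈ D (w l), cylinder b) (fun l => ⋃ b ∈ D (V (w l)), cylinder b)
    (fun l' l hl => ?_) (fun l' l hl => ?_) (x₀ := x₀) (fun l => ?_) fun l hl => ?_⟩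
  · exact Set.mapsTo_iUnion₂.2 (hw hl).1
  · simp only [hV]
    exact Set.mapsTo_iUnion₂.2 fun b hb => (hw hl).2 b (Finset.mem_insert_of_mem hb)
  · rw [hV]
    have hl : (l.1, !l.2) ≠ l := by simp [Prod.ext_iff]
    exact (hw hl).2 c₀ (Finset.mem_insert_self _ _) hx₀
  · obtain ⟨b, hb, hxb⟩ := Set.mem_iUnion₂.1 hl
    exact hx₀D b (Finset.mem_biUnion.2 ⟨l, Finset.mem_univ l, hb⟩) hxb

end Free

section Alternative

open scoped Pointwise in
theorem exists_symmetric_finset_closure_eq_top (G : Type*) [Group G] [Group.FG G] :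
    ∃ T : Finset G, 1 ∈ T ∧ (∀ g ∈ T, g⁻¹ ∈ T) ∧ Subgroup.closure (T : Set G) = ⊤ := by
  classical
  obtain ⟨T, hT⟩ := Group.fg_def.1 ‹Group.FG G›
  refine ⟨insert 1 (T ∪ T⁻¹), Finset.mem_insert_self _ _, fun g hg => ?_, ?_⟩
  · simpa [or_comm] using hg
  · refine top_le_iff.1 (hT.symm.trans_le (Subgroup.closure_mono ?_))
    exact Finset.coe_subset.2 (Finset.subset_union_left.trans (Finset.subset_insert _ _))

variable {n : ℕ} {G : Type*} [Group G] [MulAction G (CantorK n)]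

theorem replacementDecay_norm_average {ι : Type*} [Fintype ι] (S : ι → G) :
    ReplacementDecay n S
      ‖(EllTwo.average S : EllTwo (CantorK n → CantorK n) →L[ℝ] EllTwo (CantorK n → CantorK n))‖ :=
  fun k b c => (freq_mono fun _ hw => funext hw).trans
    (freq_wordProd_smul_eq_le S k (prepend b) (prepend c))

/-- The walk is run on maps `CantorK n → CantorK n`, where replacing a prefix `b` by `c` means
moving from the point `prepend b` to the point `prepend c`; evaluation at an end turns an invariant
mean on maps into one on ends. -/
theorem exists_injective_freeGroup_of_not_exists_invariant_mean [Group.FG G] (hn : 2 ≤ n)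
    (hG : ∀ g : G, ∃ L, LosesAtMost n L g)
    (hm : ¬ ∃ m : Mean (CantorK n), m.IsInvariant G) (α : Type*) [Finite α] :
    ∃ φ : FreeGroup α →* G, Function.Injective φ := by
  have := Fintype.ofFinite α
  obtain ⟨T, hone, hinv, hT⟩ := exists_symmetric_finset_closure_eq_top G
  let S : T → G := Subtype.val
  let σ : Equiv.Perm T := Function.Involutive.toPerm (fun g => ⟨g.1⁻¹, hinv g.1 g.2⟩)
    fun g => Subtype.ext (inv_inv g.1)
  obtain ⟨L, hL⟩ := (eventually_all.2 fun g : T =>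
    (hG g).elim fun _ => LosesAtMost.eventually).exists
  have hmaps : ¬ ∃ m : Mean (CantorK n → CantorK n), m.IsInvariant G := fun ⟨m, hm'⟩ =>
    hm ⟨m.map fun f => f fun _ => ⟨0, by lia⟩, hm'.map fun _ _ => rfl⟩
  have hρ := EllTwo.norm_average_lt_one (S := S) (by simpa [S] using hT) ⟨⟨1, hone⟩, rfl⟩ hmaps
  let r : ℝ := (Fintype.card (α × Bool) : ℝ) ^ 2 * 2
  obtain ⟨η, d, hη, hd, hcap⟩ := exists_captures hL (norm_nonneg _) hρ
    (replacementDecay_norm_average S) (ε := 1 / (r + 1)) (by positivity)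
  have : Nonempty T := ⟨⟨1, hone⟩⟩
  refine exists_injective_freeGroup_of_captures hn σ (fun _ => rfl) hη ?_ hcap
  rw [lt_div_iff₀' (by positivity), add_one_mul] at hd
  rw [← mul_assoc]
  exact (le_add_of_nonneg_right (by positivity)).trans_lt hd

end Alternative

section Thompson

variable {n : ℕ}

instance : MulAction (ThompsonV n) (CantorK n) where
  smul g x := g.1 x
  one_smul _ := rfl
  mul_smul _ _ _ := rfl

theorem ThompsonV.exists_losesAtMost (g : ThompsonV n) : ∃ L, LosesAtMost n L g := by
  obtain ⟨A, B, τ, hg⟩ := g.2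
  obtain ⟨L, hL⟩ := A.exists_prefix
  obtain ⟨K, hK⟩ := (A.endpoints_finite.image List.length).bddAbove
  refine ⟨L + K, fun b hb => ?_⟩
  obtain ⟨a, ha, u, rfl⟩ := hL b (by lia)
  have hlen : a.length ≤ K := hK ⟨a, ha, rfl⟩
  refine ⟨τ ⟨a, ha⟩ ++ u, fun x => ?_, by simp only [List.length_append]; lia⟩
  rw [prepend_append, prepend_append]
  exact hg ⟨a, ha⟩ _

end Thompson

/-- For `n ≥ 2`, a finitely generated subgroup `Γ` of Thompson's group `V_n` has a finite orbit in
the Cantor set `K_n` or contains a free group on two generators. -/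
theorem theorem1p4 (n : ℕ) (hn : 2 ≤ n) (Γ : Subgroup (ThompsonV n)) (hΓ : Γ.FG) :
    (∃ p : CantorK n, {q : CantorK n | ∃ g ∈ Γ, g.1 p = q}.Finite) ∨
      (∃ φ : FreeGroup (Fin 2) →* Γ, Function.Injective φ) := by
  have : Group.FG Γ := (Group.fg_iff_subgroup_fg Γ).2 hΓ
  have hΓL (g : Γ) : ∃ L, LosesAtMost n L g := ThompsonV.exists_losesAtMost g.1
  by_cases h : ∃ m : Mean (CantorK n), m.IsInvariant Γ
  · obtain ⟨m, hm⟩ := h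
    obtain ⟨p, hp⟩ := exists_finite_orbit_of_invariant_mean hΓL hm
    refine Or.inl ⟨p, hp.subset ?_⟩
    rintro _ ⟨g, hg, rfl⟩
    exact ⟨⟨g, hg⟩, rfl⟩
  · exact Or.inr (exists_injective_freeGroup_of_not_exists_invariant_mean hn hΓL h _)
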